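/- Let $ABC$ be a (non-degenerate) triangle in the Lobachevskii (hyperbolic) plane of curvature $-1$, with sides $BC=a$, $AC=b$, $AB=c$ and opposite angles $\alpha,\beta,\gamma$ at $A,B,C$, and let its area be the angle defect $S=\pi-(\alpha+\beta+\gamma)$. Then the following conditions are equivalent: (0) $ABC$ has the maximum area among all triangles $A'B'C'$ with $A'C'=b$ and $A'B'=c$; (1) $\alpha=\beta+\gamma<\frac{\pi}{2}$; (2) $ABC$ has a circumscribed circle, and its center coincides with the midpoint of the side $BC$; (3) $\sin\frac S2=\tanh\frac b2\cdot\tanh\frac c2$; (4) $\cos\alpha=\tanh\frac b2\cdot\tanh\frac c2$; (5) $\sinh^2\frac a2=\sinh^2\frac b2+\sinh^2\frac c2$. Moreover, $\cos\alpha$ in (4) is not constant: there is no real number $k$ such that $\cos\alpha=k$ for all triangles $ABC$ (with arbitrary $b$ and $c$) which satisfy (0). -/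

import Mathlib

open scoped Complex.UnitDisc ComplexConjugate

noncomputable section

namespace PoincareDisc

/-- Hyperbolic distance (curvature `-1`) in the Poincaré disc:
`d(z, w) = 2 artanh |(w - z) / (1 - z̄ w)|`. -/
def hdist (z w : 𝔻) : ℝ :=
  2 * Real.artanh ‖((w : ℂ) - z) / (1 - conj (z : ℂ) * w)‖

/-- Hyperbolic lines: the parts inside the disc of diameters and of Euclidean circles orthogonal to
the unit circle (a circle with centre `p` and radius `r` is orthogonal to the unit circle iff
`|p|² = 1 + r²`). -/
def IsLine (l : Set 𝔻) : Prop :=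
  (∃ p : ℂ, p ≠ 0 ∧ l = {z : 𝔻 | (conj p * (z : ℂ)).re = 0}) ∨
  (∃ (p : ℂ) (r : ℝ), 0 < r ∧ ‖p‖ ^ 2 = 1 + r ^ 2 ∧ l = {z : 𝔻 | ‖(z : ℂ) - p‖ = r})

/-- Three points are the vertices of a triangle iff no hyperbolic line contains all of them. -/
def IsTriangle (A B C : 𝔻) : Prop :=
  ¬ ∃ l : Set 𝔻, IsLine l ∧ A ∈ l ∧ B ∈ l ∧ C ∈ l

/-- Parametrization, for `t ∈ [0, 1]`, of the hyperbolic segment from `z` to `w`. It is the image of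
the Euclidean radius from `0` to `(w - z) / (1 - z̄ w)` under the automorphism
`u ↦ (z + u) / (1 + z̄ u)` of the disc, which takes `0` to `z`. -/
def segment (z w : 𝔻) (t : ℝ) : ℂ :=
  ((z : ℂ) + t * (((w : ℂ) - z) / (1 - conj (z : ℂ) * w))) /
    (1 + conj (z : ℂ) * (t * (((w : ℂ) - z) / (1 - conj (z : ℂ) * w))))

/-- Euclidean tangent vector at `z` of the hyperbolic segment from `z` to `w`. -/
def tangent (z w : 𝔻) : ℂ := deriv (segment z w) 0

/-- The angle `∠PQR` with vertex `Q`: the Euclidean angle between the arcs `QP` and `QR`, i.e.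
between their tangent vectors at `Q` (the model is conformal). -/
def hangle (P Q R : 𝔻) : ℝ := InnerProductGeometry.angle (tangent Q P) (tangent Q R)

/-- Area of a triangle, i.e. its angle defect `π - (α + β + γ)`. -/
def area (A B C : 𝔻) : ℝ := Real.pi - (hangle B A C + hangle A B C + hangle A C B)

/-- The triangle `ABC` has the maximal area among all triangles `A'B'C'` with `A'C' = AC` and
`A'B' = AB`. -/
def HasMaximalArea (A B C : 𝔻) : Prop :=
  ∀ A' B' C' : 𝔻, IsTriangle A' B' C' → hdist A' C' = hdist A C → hdist A' B' = hdist A B →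
    area A' B' C' ≤ area A B C

/-- `O` is the centre of a hyperbolic circle through `A`, `B` and `C`. -/
def IsCircumcenter (O A B C : 𝔻) : Prop :=
  hdist O A = hdist O B ∧ hdist O B = hdist O C

/-- `M` is the midpoint of the hyperbolic segment `PQ`. -/
def IsMidpoint (M P Q : 𝔻) : Prop :=
  hdist P M = hdist P Q / 2 ∧ hdist M Q = hdist P Q / 2

end PoincareDisc

end

/-!
The conditions are compared after the triangle is normalised. The automorphism `recenter A` of the
disc moves `A` to `0`, and `B`, `C` to points `u`, `v`; distances and angles do not change, because
conjugating by an automorphism alters the maps `recenter` only by rotations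
(`coe_recenter_recenter`). All the metric data of the triangle are then carried by one complex
number `V` in the upper half-plane, namely `ū v` or its conjugate. Its modulus is
`tanh (b / 2) tanh (c / 2)` and its argument is `α`. The hyperbolic angles of `0, u, v` at `u` and
`v` are the Euclidean ones diminished by `arg (1 - V̄)`, hence `S = 2 arg (1 - V̄)`
(`arg_add_arg_add_arg`, `hangle_area_zero`). Moreover `sinh² (a / 2)` differs from
`sinh² (b / 2) + sinh² (c / 2)` by a positive multiple of `|V|² - Re V` (`exists_invariant`).

Each of (1), (3), (4), (5) thereby becomes `Re V = |V|²`: for (4) and (5) this is immediate; (1)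
says that `α + S / 2 = π / 2`, that is, that `V (1 - V̄)` is purely imaginary; and for (3) the
identity `(Im V)² + (Re V - |V|²)² = |V|² |1 - V̄|²` gives `sin (S / 2) ≤ |V|`, with equality
exactly if `Re V = |V|²` (`sin_arg_one_sub_conj`).

This inequality also settles (0): the bound `|V|` depends on `b` and `c` only, and since
`0 < S / 2 < π / 2` maximal area means maximal `sin (S / 2)`. The bound is attained, as for any `b`
and `c` there is a triangle which satisfies (4) (`exists_isTriangle`). Its angle depends on `b` and
`c`, which gives the last claim. To compare the two sides in this way, one needs that noncollinear
points have `Im (ū v) ≠ 0`, which is proved by writing down the line through `A` in a given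
direction (`isLine_setOf_im_eq_zero`).

For (2), the midpoint `M` of `BC` is moved to `0`, so that `C = -B`, and the parallelogram law turns
`MA = MB` into (5) (`hdist_midpoint_eq_iff`).
-/

namespace PoincareDisc

/-! ### Automorphisms of the disc -/

theorem one_sub_conj_mul_ne_zero (a z : 𝔻) : 1 - conj (a : ℂ) * z ≠ 0 := by
  intro h
  have h1 : ‖conj (a : ℂ) * z‖ = 1 := by rw [← sub_eq_zero.mp h]; simp
  rw [norm_mul, Complex.norm_conj] at h1
  nlinarith [a.norm_lt_one, z.norm_lt_one, norm_nonneg (a : ℂ), norm_nonneg (z : ℂ)]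

theorem one_sub_normSq_mobius {a z : ℂ} (h : 1 - conj a * z ≠ 0) :
    1 - Complex.normSq ((z - a) / (1 - conj a * z)) =
      (1 - Complex.normSq a) * (1 - Complex.normSq z) / Complex.normSq (1 - conj a * z) := by
  have h' : Complex.normSq (1 - conj a * z) ≠ 0 := by simpa using h
  rw [Complex.normSq_div, eq_div_iff h', sub_mul, div_mul_cancel₀ _ h']
  simp [Complex.normSq_apply]
  ring

theorem norm_mobius_lt_one (a z : 𝔻) : ‖((z : ℂ) - a) / (1 - conj (a : ℂ) * z)‖ < 1 := by
  have h := one_sub_normSq_mobius (one_sub_conj_mul_ne_zero a z)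
  have h2 : 0 < (1 - Complex.normSq (a : ℂ)) * (1 - Complex.normSq (z : ℂ)) /
      Complex.normSq (1 - conj (a : ℂ) * z) :=
    div_pos (mul_pos (sub_pos.2 a.normSq_lt_one) (sub_pos.2 z.normSq_lt_one))
      (Complex.normSq_pos.2 (one_sub_conj_mul_ne_zero a z))
  rw [← h, Complex.normSq_eq_norm_sq] at h2
  nlinarith [norm_nonneg (((z : ℂ) - a) / (1 - conj (a : ℂ) * z))]

/-- The automorphism `z ↦ (z - a) / (1 - ā z)` of the disc, which takes `a` to `0`. -/
noncomputable def recenter (a z : 𝔻) : 𝔻 :=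
  Complex.UnitDisc.mk (((z : ℂ) - a) / (1 - conj (a : ℂ) * z)) (norm_mobius_lt_one a z)

theorem coe_recenter (a z : 𝔻) :
    (recenter a z : ℂ) = ((z : ℂ) - a) / (1 - conj (a : ℂ) * z) := rfl

@[simp] theorem recenter_self (a : 𝔻) : recenter a a = 0 := by
  rw [← Complex.UnitDisc.coe_inj, coe_recenter]; simp

@[simp] theorem recenter_zero (z : 𝔻) : recenter 0 z = z := by
  rw [← Complex.UnitDisc.coe_inj, coe_recenter]; simp

theorem coe_recenter_zero_right (a : 𝔻) : (recenter a 0 : ℂ) = -(a : ℂ) := by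
  rw [coe_recenter]; simp

/-- The automorphism `recenter (-a)` is inverse to `recenter a`. -/
theorem recenter_recenter_neg (a z : 𝔻) : recenter a (recenter (-a) z) = z := by
  rw [← Complex.UnitDisc.coe_inj, coe_recenter, coe_recenter]
  have h := one_sub_conj_mul_ne_zero (-a) z
  have h2 : (1 : ℂ) - conj (a : ℂ) * a ≠ 0 := one_sub_conj_mul_ne_zero a a
  simp only [Complex.UnitDisc.coe_neg, map_neg, neg_mul, sub_neg_eq_add] at h ⊢
  have e1 : (z + a : ℂ) / (1 + conj (a : ℂ) * z) - a
      = z * (1 - conj (a : ℂ) * a) / (1 + conj (a : ℂ) * z) := by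
    rw [div_sub' h]; ring
  have e2 : 1 - conj (a : ℂ) * ((z + a : ℂ) / (1 + conj (a : ℂ) * z))
      = (1 - conj (a : ℂ) * a) / (1 + conj (a : ℂ) * z) := by
    rw [mul_div_assoc', one_sub_div h]; ring
  rw [e1, e2, div_div_div_cancel_right₀ h, mul_div_cancel_right₀ _ h2]

/-- Conjugating by an automorphism changes the automorphisms `recenter` by a rotation only, so that
distances and angles, which are read off from `recenter`, are invariant. -/
theorem coe_recenter_recenter (a b z : 𝔻) :
    (recenter (recenter a b) (recenter a z) : ℂ) =
      (1 - (a : ℂ) * conj (b : ℂ)) / (1 - conj (a : ℂ) * b) * recenter b z := by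
  simp only [coe_recenter]
  have h1 := one_sub_conj_mul_ne_zero a b
  have h2 := one_sub_conj_mul_ne_zero a z
  have h3 := one_sub_conj_mul_ne_zero b z
  have h4 : 1 - (a : ℂ) * conj (b : ℂ) ≠ 0 := by
    simpa [mul_comm] using one_sub_conj_mul_ne_zero b a
  have h5 : (1 : ℂ) - conj (a : ℂ) * a ≠ 0 := one_sub_conj_mul_ne_zero a a
  have e1 : (z - a : ℂ) / (1 - conj (a : ℂ) * z) - (b - a) / (1 - conj (a : ℂ) * b) =
      (z - b) * (1 - conj (a : ℂ) * a) / ((1 - conj (a : ℂ) * z) * (1 - conj (a : ℂ) * b)) := by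
    rw [div_sub_div _ _ h2 h1]; ring
  have e2 : 1 - conj ((b - a : ℂ) / (1 - conj (a : ℂ) * b)) * ((z - a) / (1 - conj (a : ℂ) * z)) =
      (1 - conj (b : ℂ) * z) * (1 - conj (a : ℂ) * a) /
        ((1 - conj (a : ℂ) * z) * (1 - (a : ℂ) * conj (b : ℂ))) := by
    simp only [map_div₀, map_sub, map_one, map_mul, Complex.conj_conj]
    rw [div_mul_div_comm, mul_comm (conj (b : ℂ)), mul_comm (1 - (a : ℂ) * conj (b : ℂ)),
      one_sub_div (mul_ne_zero h2 h4)]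
    ring
  rw [e1, e2]
  generalize 1 - conj (a : ℂ) * b = p at *
  generalize 1 - conj (a : ℂ) * z = q at *
  generalize 1 - conj (b : ℂ) * z = r at *
  generalize 1 - conj (a : ℂ) * a = t at *
  generalize 1 - (a : ℂ) * conj (b : ℂ) = s at *
  field_simp

theorem norm_rotation_eq_one (a b : 𝔻) :
    ‖(1 - (a : ℂ) * conj (b : ℂ)) / (1 - conj (a : ℂ) * b)‖ = 1 := by
  have h : (1 - (a : ℂ) * conj (b : ℂ)) = conj (1 - conj (a : ℂ) * b) := by simp
  rw [h, norm_div, Complex.norm_conj, div_self]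
  exact norm_ne_zero_iff.2 (one_sub_conj_mul_ne_zero a b)

/-! ### Distances -/

theorem hdist_eq (z w : 𝔻) : hdist z w = 2 * Real.artanh ‖(recenter z w : ℂ)‖ := rfl

theorem hdist_recenter (a z w : 𝔻) : hdist (recenter a z) (recenter a w) = hdist z w := by
  rw [hdist_eq, hdist_eq, coe_recenter_recenter, norm_mul, norm_rotation_eq_one, one_mul]

theorem hdist_nonneg (z w : 𝔻) : 0 ≤ hdist z w :=
  mul_nonneg zero_le_two (Real.artanh_nonneg (norm_nonneg _))

theorem norm_mem_Ioo (z : 𝔻) : ‖(z : ℂ)‖ ∈ Set.Ioo (-1 : ℝ) 1 :=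
  ⟨by linarith [norm_nonneg (z : ℂ)], z.norm_lt_one⟩

theorem tanh_half_hdist (z w : 𝔻) : Real.tanh (hdist z w / 2) = ‖(recenter z w : ℂ)‖ := by
  rw [hdist_eq, mul_div_cancel_left₀ _ two_ne_zero, Real.tanh_artanh (norm_mem_Ioo _)]

theorem sinh_sq_half_hdist (z w : 𝔻) : Real.sinh (hdist z w / 2) ^ 2 =
    Complex.normSq (z - w) / ((1 - Complex.normSq z) * (1 - Complex.normSq w)) := by
  have h := one_sub_normSq_mobius (one_sub_conj_mul_ne_zero z w)
  have h1 := Complex.normSq_pos.2 (one_sub_conj_mul_ne_zero z w)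
  have hz := sub_pos.2 z.normSq_lt_one
  have hw := sub_pos.2 w.normSq_lt_one
  have h2 := sub_pos.2 (recenter z w).normSq_lt_one
  rw [hdist_eq, mul_div_cancel_left₀ _ two_ne_zero, Real.sinh_artanh (norm_mem_Ioo _), div_pow,
    ← Complex.normSq_eq_norm_sq, Real.sq_sqrt h2.le, coe_recenter, h, Complex.normSq_div,
    ← neg_sub, Complex.normSq_neg]
  generalize Complex.normSq (1 - conj (z : ℂ) * w) = r at *
  field_simp

theorem hdist_comm (z w : 𝔻) : hdist z w = hdist w z := by
  rw [hdist_eq, hdist_eq, coe_recenter, coe_recenter, norm_div, norm_div, norm_sub_rev,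
    ← Complex.norm_conj (1 - _)]
  simp [mul_comm]

theorem sinh_sq_half_hdist_zero (z : 𝔻) : Real.sinh (hdist 0 z / 2) ^ 2 =
    Complex.normSq z / (1 - Complex.normSq z) := by
  rw [sinh_sq_half_hdist]; simp

theorem hdist_zero (z : 𝔻) : hdist 0 z = 2 * Real.artanh ‖(z : ℂ)‖ := by
  rw [hdist_eq, recenter_zero]

theorem hdist_zero_inj {z w : 𝔻} :
    hdist 0 z = hdist 0 w ↔ Complex.normSq z = Complex.normSq w := by
  rw [hdist_zero, hdist_zero, Complex.normSq_eq_norm_sq, Complex.normSq_eq_norm_sq,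
    sq_eq_sq₀ (norm_nonneg _) (norm_nonneg _), mul_right_inj' two_ne_zero]
  exact Real.artanh_injOn.eq_iff (norm_mem_Ioo z) (norm_mem_Ioo w)

/-! ### Midpoints and the circumcentre condition -/

theorem exists_isMidpoint (P Q : 𝔻) : ∃ M, IsMidpoint M P Q := by
  set w := recenter P Q with hw
  set s := Real.tanh (hdist P Q / 4) with hs
  have hs1 : s < 1 := Real.tanh_lt_one _
  have hs0 : 0 ≤ s := by
    rw [hs, Real.tanh_eq_sinh_div_cosh]
    exact div_nonneg (Real.sinh_nonneg_iff.2 (by linarith [hdist_nonneg P Q])) (Real.cosh_pos _).le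
  have hart : Real.artanh s = hdist P Q / 4 := Real.artanh_tanh _
  have hws : ‖(w : ℂ)‖ = 2 * s / (1 + s ^ 2) := by
    rw [hw, ← tanh_half_hdist, show hdist P Q / 2 = 2 * (hdist P Q / 4) by ring, hs,
      Real.tanh_eq_sinh_div_cosh, Real.tanh_eq_sinh_div_cosh, Real.sinh_two_mul,
      Real.cosh_two_mul]
    have := (Real.cosh_pos (hdist P Q / 4)).ne'
    field_simp
  -- The midpoint of `0` and `w` is `t w`, where `t ‖w‖ = s`.
  have hts : ‖(((1 + s ^ 2) / 2 : ℝ) : ℂ) * w‖ = s := by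
    rw [norm_mul, hws, Complex.norm_real, Real.norm_of_nonneg (by positivity)]
    field_simp
  let m : 𝔻 := Complex.UnitDisc.mk ((((1 + s ^ 2) / 2 : ℝ) : ℂ) * w) (hts.trans_lt hs1)
  have hm : (m : ℂ) = (((1 + s ^ 2) / 2 : ℝ) : ℂ) * w := rfl
  have h0 : hdist 0 m = hdist P Q / 2 := by
    rw [hdist_zero, hm, hts, hart]; ring
  have h1 : hdist m w = hdist P Q / 2 := by
    have hden : 1 - conj (m : ℂ) * w = (((1 - s ^ 2) / (1 + s ^ 2) : ℝ) : ℂ) := by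
      have : conj (m : ℂ) * w = (((1 + s ^ 2) / 2 * ‖(w : ℂ)‖ ^ 2 : ℝ) : ℂ) := by
        rw [hm, map_mul, Complex.conj_ofReal, mul_assoc, Complex.conj_mul']
        push_cast; ring
      rw [this, hws, ← Complex.ofReal_one, ← Complex.ofReal_sub]
      congr 1
      field_simp; ring
    have hnum : (w : ℂ) - m = (((1 - s ^ 2) / 2 : ℝ) : ℂ) * w := by
      rw [hm]; push_cast; ring
    have h2 : 0 < 1 - s ^ 2 := by nlinarith
    rw [hdist_eq, coe_recenter, hnum, hden, norm_div, norm_mul, Complex.norm_real,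
      Complex.norm_real, Real.norm_of_nonneg (by positivity), Real.norm_of_nonneg (by positivity),
      hws, show (1 - s ^ 2) / 2 * (2 * s / (1 + s ^ 2)) / ((1 - s ^ 2) / (1 + s ^ 2)) = s by
        field_simp, hart]
    ring
  refine ⟨recenter (-P) m, ?_, ?_⟩
  · rw [← hdist_recenter P, recenter_recenter_neg, recenter_self, h0]
  · rw [← hdist_recenter P, recenter_recenter_neg, h1]

/-- A midpoint at the centre of the disc is the Euclidean midpoint. -/
theorem eq_neg_of_isMidpoint_zero {P Q : 𝔻} (h : IsMidpoint 0 P Q) : Q = -P := by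
  obtain ⟨h1, h2⟩ := h
  rw [hdist_comm] at h1
  have h3 := hdist_zero_inj.1 (h1.trans h2.symm)
  have hp := sub_pos.2 P.normSq_lt_one
  have h4 := sinh_sq_half_hdist P Q
  have h5 := sinh_sq_half_hdist_zero P
  rw [← h1, show hdist 0 P = 2 * (hdist 0 P / 2) by ring, Real.sinh_two_mul, mul_pow, mul_pow,
    Real.cosh_sq, h5, ← h3] at h4
  have h6 : Complex.normSq (P - Q) = 4 * Complex.normSq P := by
    field_simp at h4
    linarith
  have h7 : Complex.normSq (Q - -P) = 0 := by
    simp only [Complex.normSq_apply, Complex.sub_re, Complex.sub_im, Complex.neg_re,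
      Complex.neg_im] at h3 h6 ⊢
    nlinarith
  rw [← Complex.UnitDisc.coe_inj, Complex.UnitDisc.coe_neg]
  exact sub_eq_zero.1 (Complex.normSq_eq_zero.1 h7)

/-- The midpoint `M` of `BC` is equidistant from `A` and `B` exactly if
`sinh² (BC / 2) = sinh² (AC / 2) + sinh² (AB / 2)`; this is read off after moving `M` to `0`. -/
theorem hdist_midpoint_eq_iff {A B C M : 𝔻} (h : IsMidpoint M B C) :
    hdist M A = hdist M B ↔ Real.sinh (hdist B C / 2) ^ 2 =
      Real.sinh (hdist A C / 2) ^ 2 + Real.sinh (hdist A B / 2) ^ 2 := by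
  have h' : IsMidpoint 0 (recenter M B) (recenter M C) := by
    simpa only [IsMidpoint, ← recenter_self M, hdist_recenter] using h
  have hC := eq_neg_of_isMidpoint_zero h'
  rw [← hdist_recenter M M, ← hdist_recenter M M, ← hdist_recenter M B, ← hdist_recenter M A,
    ← hdist_recenter M A, hC, recenter_self, hdist_zero_inj, sinh_sq_half_hdist,
    sinh_sq_half_hdist, sinh_sq_half_hdist]
  generalize recenter M A = a
  generalize recenter M B = b
  have ha := sub_pos.2 a.normSq_lt_one
  have hb := sub_pos.2 b.normSq_lt_one
  have e1 : Complex.normSq ((b : ℂ) - (-b : 𝔻)) = 4 * Complex.normSq b := by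
    simp [Complex.normSq_apply]; ring
  have e2 : Complex.normSq ((a : ℂ) - (-b : 𝔻)) =
      2 * Complex.normSq a + 2 * Complex.normSq b - Complex.normSq ((a : ℂ) - b) := by
    simp [Complex.normSq_apply]; ring
  rw [e1, e2, Complex.UnitDisc.coe_neg, Complex.normSq_neg]
  have hb0 := Complex.normSq_nonneg (b : ℂ)
  generalize Complex.normSq ((a : ℂ) - b) = d
  generalize Complex.normSq (a : ℂ) = p at *
  generalize Complex.normSq (b : ℂ) = q at *
  have key : 4 * q / ((1 - q) * (1 - q)) - ((2 * p + 2 * q - d) / ((1 - p) * (1 - q)) +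
      d / ((1 - p) * (1 - q))) = 2 * (q - p) * (1 + q) / ((1 - p) * (1 - q) ^ 2) := by
    field_simp; ring
  rw [← sub_eq_zero (b := (2 * p + 2 * q - d) / ((1 - p) * (1 - q)) + _), key,
    div_eq_zero_iff]
  have hden : (1 - p) * (1 - q) ^ 2 ≠ 0 := by positivity
  have hq : 1 + q ≠ 0 := by positivity
  simp only [hden, or_false, mul_eq_zero, hq, two_ne_zero, false_or, sub_eq_zero]
  exact eq_comm

theorem exists_circumcenter_isMidpoint_iff (A B C : 𝔻) :
    (∃ O, IsCircumcenter O A B C ∧ IsMidpoint O B C) ↔ Real.sinh (hdist B C / 2) ^ 2 =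
      Real.sinh (hdist A C / 2) ^ 2 + Real.sinh (hdist A B / 2) ^ 2 := by
  constructor
  · rintro ⟨O, h, hM⟩
    exact (hdist_midpoint_eq_iff hM).1 h.1
  · intro h
    obtain ⟨M, hM⟩ := exists_isMidpoint B C
    refine ⟨M, ⟨(hdist_midpoint_eq_iff hM).2 h, ?_⟩, hM⟩
    rw [hdist_comm M B, hM.1, hM.2]

/-! ### Angles -/

theorem tangent_eq (z w : 𝔻) :
    tangent z w = ((1 - Complex.normSq z : ℝ) : ℂ) * recenter z w := by
  have h1 : HasDerivAt (fun t : ℝ => (t : ℂ) * recenter z w) (recenter z w) 0 := by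
    simpa using (Complex.ofRealCLM.hasDerivAt (x := (0 : ℝ))).mul_const (recenter z w : ℂ)
  have h2 := (h1.const_add (z : ℂ)).div ((h1.const_mul (conj (z : ℂ))).const_add 1) (by simp)
  have h3 : HasDerivAt (segment z w) _ 0 := h2
  rw [tangent, h3.deriv]
  push_cast
  rw [← Complex.mul_conj]
  simp
  ring

theorem hangle_eq (P Q R : 𝔻) :
    hangle P Q R = InnerProductGeometry.angle (recenter Q P : ℂ) (recenter Q R) := by
  rw [hangle, tangent_eq, tangent_eq, Complex.angle_mul_left]
  exact_mod_cast (sub_pos.2 Q.normSq_lt_one).ne'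

theorem hangle_recenter (a P Q R : 𝔻) :
    hangle (recenter a P) (recenter a Q) (recenter a R) = hangle P Q R := by
  rw [hangle_eq, hangle_eq, coe_recenter_recenter, coe_recenter_recenter, Complex.angle_mul_left]
  exact norm_ne_zero_iff.1 (by rw [norm_rotation_eq_one]; exact one_ne_zero)

theorem area_recenter (a A B C : 𝔻) :
    area (recenter a A) (recenter a B) (recenter a C) = area A B C := by
  simp only [area, hangle_recenter]

theorem abs_arg_conj (z : ℂ) : |(conj z).arg| = |z.arg| := by
  rw [Complex.arg_conj]
  split_ifs with h
  · rw [h]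
  · rw [abs_neg]

theorem angle_eq_abs_arg_of_conj_mul {p q Z : ℂ} {r : ℝ} (hr : 0 < r) (hZ : Z ≠ 0)
    (h : conj p * q = r * Z) : InnerProductGeometry.angle p q = |Z.arg| := by
  have h0 : conj p * q ≠ 0 := by
    rw [h]
    exact mul_ne_zero (by exact_mod_cast hr.ne') hZ
  have hp : p ≠ 0 := by rintro rfl; simp at h0
  have hq : q ≠ 0 := by rintro rfl; simp at h0
  have hn := Complex.normSq_pos.2 hp
  have e : q / p = ((r / Complex.normSq p : ℝ) : ℂ) * Z := by
    have : (Complex.normSq p : ℂ) ≠ 0 := by exact_mod_cast hn.ne'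
    push_cast
    rw [div_mul_eq_mul_div, ← h, div_eq_div_iff hp this, ← Complex.mul_conj]
    ring
  rw [InnerProductGeometry.angle_comm, Complex.angle_eq_abs_arg hq hp, e,
    Complex.arg_real_mul _ (div_pos hr hn)]

theorem arg_pos_of_im_pos {z : ℂ} (hz : 0 < z.im) : 0 < z.arg :=
  (Complex.arg_nonneg_iff.2 hz.le).lt_of_ne' fun h => hz.ne' (Complex.arg_eq_zero_iff.1 h).2

theorem arg_mul_of_im_pos {z w : ℂ} (hz : 0 < z.im) (hzw : 0 < (z * w).im) :
    (z * w).arg = z.arg + w.arg := by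
  have hz0 : z ≠ 0 := by rintro rfl; simp at hz
  have hzw0 : z * w ≠ 0 := by intro h; simp [h] at hzw
  have h1 : z.arg ≠ Real.pi := fun h => hz.ne' (Complex.arg_eq_pi_iff.1 h).2
  have h2 : (z⁻¹).arg = -z.arg := by rw [Complex.arg_inv, if_neg h1]
  have h3 := arg_pos_of_im_pos hz
  have h4 : 0 ≤ (z * w).arg := Complex.arg_nonneg_iff.2 hzw.le
  -- Both arguments lie in `[0, π]`, hence their difference is the argument of the quotient `w`.
  have h5 := Complex.arg_mul hzw0 (inv_ne_zero hz0) (by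
    rw [h2]
    exact ⟨by linarith [(Complex.arg_le_pi z).lt_of_ne h1], by linarith [Complex.arg_le_pi (z * w)]⟩)
  rw [mul_right_comm, mul_inv_cancel₀ hz0, one_mul, h2] at h5
  linarith

/-- The angle sum of the hyperbolic triangle `0, u, v` with `V = ū v`, `p = |u|²` and `q = |v|²`.
The numbers `V`, `p - V̄`, `q - V̄` have the angles of the Euclidean triangle `0, u, v` as arguments,
which add up to `π`; each of the two factors `1 - V` subtracts `arg (1 - V̄)`. -/
theorem arg_add_arg_add_arg {V : ℂ} {p q : ℝ} (hV : 0 < V.im) (hp : 0 < p) (hp1 : p < 1)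
    (hq1 : q < 1) (h : Complex.normSq V = p * q) :
    V.arg + ((p - conj V) * (1 - V)).arg + ((q - conj V) * (1 - V)).arg =
      Real.pi - 2 * (1 - conj V).arg := by
  have hconj : (1 - V).arg = -(1 - conj V).arg := by
    have h1 : (1 - V) = conj (1 - conj V) := by simp
    rw [h1, Complex.arg_conj, if_neg]
    intro h2
    have := (Complex.arg_eq_pi_iff.1 h2).2
    simp at this
    exact hV.ne' this
  have split {t : ℝ} (ht : t < 1) :
      (((t : ℂ) - conj V) * (1 - V)).arg = ((t : ℂ) - conj V).arg - (1 - conj V).arg := by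
    have him : (((t : ℂ) - conj V) * (1 - V)).im = (1 - t) * V.im := by simp; ring
    rw [arg_mul_of_im_pos (by simpa using hV) (him ▸ mul_pos (sub_pos.2 ht) hV), hconj]
    ring
  have e : V * (p - conj V) = p * (V - q) := by
    rw [mul_sub, Complex.mul_conj, h]; push_cast; ring
  have h1 : V.arg + ((p : ℂ) - conj V).arg = (V - q).arg := by
    rw [← arg_mul_of_im_pos hV, e, Complex.arg_real_mul _ hp]
    rw [e]
    simpa using mul_pos hp hV
  have h2 : ((q : ℂ) - conj V).arg = Real.pi - (V - q).arg := by
    have h3 : (q : ℂ) - conj V = -conj (V - q) := by simp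
    rw [h3, Complex.arg_neg_eq_arg_add_pi_of_im_neg (by simpa using hV), Complex.arg_conj, if_neg]
    · ring
    · intro h4
      have := (Complex.arg_eq_pi_iff.1 h4).2
      simp at this
      exact hV.ne' this
  rw [split hp1, split hq1, h2, ← h1]
  ring

/-- The angle and the area of the triangle `0, u, v`, where `V` is `ū v` or, if `v` lies clockwise
from `u`, its conjugate. -/
theorem hangle_area_zero {u v : 𝔻} {V : ℂ} (hV : 0 < V.im)
    (h : conj (u : ℂ) * v = V ∨ conj (u : ℂ) * v = conj V) :
    hangle u 0 v = V.arg ∧ area 0 u v = 2 * (1 - conj V).arg := by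
  have hV0 : V ≠ 0 := by rintro rfl; simp at hV
  have hn : Complex.normSq V = Complex.normSq u * Complex.normSq v := by
    rw [← Complex.normSq_conj (u : ℂ), ← Complex.normSq_mul]
    rcases h with h | h <;> simp [h]
  have hnV := Complex.normSq_pos.2 hV0
  have hu0 : 0 < Complex.normSq (u : ℂ) := by
    refine (Complex.normSq_nonneg _).lt_of_ne' fun h0 => ?_
    rw [h0, zero_mul] at hn
    exact hnV.ne' hn
  have hα : hangle u 0 v = |V.arg| := by
    rw [hangle_eq, recenter_zero, recenter_zero]
    rcases h with h | h
    · exact angle_eq_abs_arg_of_conj_mul one_pos hV0 (by simpa using h)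
    · rw [← abs_arg_conj]
      exact angle_eq_abs_arg_of_conj_mul one_pos (by simpa using hV0) (by simpa using h)
  -- The angle at `a` is the argument of `(|a|² - V̄) (1 - V)`, up to complex conjugation.
  have base {a b : 𝔻} (hab : conj (a : ℂ) * b = V ∨ conj (a : ℂ) * b = conj V) :
      hangle 0 a b = |(((Complex.normSq (a : ℂ) : ℂ) - conj V) * (1 - V)).arg| := by
    have hden := one_sub_conj_mul_ne_zero a b
    have hr := Complex.normSq_pos.2 hden
    have hZ : ((Complex.normSq (a : ℂ) : ℂ) - conj V) * (1 - V) ≠ 0 := by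
      refine mul_ne_zero ?_ ?_ <;> intro h0 <;> have := congrArg Complex.im h0 <;>
        simp at this <;> exact hV.ne' this
    have e : conj (-(a : ℂ)) * ((b - a) / (1 - conj (a : ℂ) * b)) =
        ((Complex.normSq (1 - conj (a : ℂ) * b))⁻¹ : ℝ) *
          ((Complex.normSq (a : ℂ) - conj (a : ℂ) * b) * (1 - conj (conj (a : ℂ) * b))) := by
      rw [div_eq_mul_inv, Complex.inv_def, ← Complex.mul_conj (a : ℂ)]
      simp only [map_sub, map_one, map_neg, map_mul, Complex.conj_conj]
      ring
    rw [hangle_eq, coe_recenter_zero_right, coe_recenter]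
    rcases hab with hab | hab
    · rw [← abs_arg_conj]
      refine angle_eq_abs_arg_of_conj_mul (inv_pos.2 hr) ((map_ne_zero _).2 hZ) (e.trans ?_)
      simp [hab]
    · refine angle_eq_abs_arg_of_conj_mul (inv_pos.2 hr) hZ (e.trans ?_)
      rw [hab, Complex.conj_conj]
  have him {a : 𝔻} : 0 < (((Complex.normSq (a : ℂ) : ℂ) - conj V) * (1 - V)).im := by
    have : (((Complex.normSq (a : ℂ) : ℂ) - conj V) * (1 - V)).im =
        (1 - Complex.normSq (a : ℂ)) * V.im := by simp; ring
    rw [this]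
    exact mul_pos (sub_pos.2 a.normSq_lt_one) hV
  have h' : conj (v : ℂ) * u = V ∨ conj (v : ℂ) * u = conj V := by
    have hc : conj (v : ℂ) * u = conj (conj (u : ℂ) * v) := by simp [mul_comm]
    rw [hc]
    rcases h with h | h <;> simp [h]
  rw [abs_of_pos (arg_pos_of_im_pos hV)] at hα
  refine ⟨hα, ?_⟩
  rw [area, hα, base h, base h', abs_of_pos (arg_pos_of_im_pos him),
    abs_of_pos (arg_pos_of_im_pos him),
    arg_add_arg_add_arg hV hu0 u.normSq_lt_one v.normSq_lt_one hn]
  ring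

/-! ### Lines and triangles -/

/-- The hyperbolic line through `A` in the direction `e`. -/
theorem isLine_setOf_im_eq_zero (A : 𝔻) {e : ℂ} (he : e ≠ 0) :
    IsLine {z : 𝔻 | (conj e * recenter A z).im = 0} := by
  have hA := sub_pos.2 A.normSq_lt_one
  have hee := Complex.normSq_pos.2 he
  set q : ℂ := conj e - e * conj (A : ℂ) ^ 2 with hq
  set s : ℝ := (conj e * A).im with hs
  have hqs : Complex.normSq q - 4 * s ^ 2 =
      Complex.normSq e * (1 - Complex.normSq (A : ℂ)) ^ 2 := by
    simp only [hq, hs, Complex.normSq_apply, pow_two, Complex.sub_re, Complex.sub_im,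
      Complex.mul_re, Complex.mul_im, Complex.conj_re, Complex.conj_im]
    ring
  have hpos : 0 < Complex.normSq e * (1 - Complex.normSq (A : ℂ)) ^ 2 := by positivity
  have key (z : 𝔻) : (conj e * recenter A z).im = 0 ↔
      (q * z).im = s * (1 + Complex.normSq (z : ℂ)) := by
    have hn := Complex.normSq_pos.2 (one_sub_conj_mul_ne_zero A z)
    have h1 : conj e * (recenter A z : ℂ) = ((Complex.normSq (1 - conj (A : ℂ) * z))⁻¹ : ℝ) *
        (conj e * (z - A) * conj (1 - conj (A : ℂ) * z)) := by
      rw [coe_recenter, div_eq_mul_inv, Complex.inv_def]; ring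
    have h2 : (conj e * (z - A) * conj (1 - conj (A : ℂ) * z)).im =
        (q * z).im - s * (1 + Complex.normSq (z : ℂ)) := by
      simp [hq, hs, Complex.normSq_apply, pow_two]
      ring
    rw [h1, Complex.im_ofReal_mul, h2, mul_eq_zero, or_iff_right (inv_pos.2 hn).ne', sub_eq_zero]
  by_cases h0 : s = 0
  · -- The line passes through `0`.
    left
    refine ⟨conj (-Complex.I * q), ?_, ?_⟩
    · have hq0 : q ≠ 0 := by
        intro hq0
        rw [hq0, h0] at hqs
        simp at hqs
        rcases hqs with h | h
        · exact he h
        · exact hA.ne' h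
      simpa using hq0
    · ext z
      simp only [Set.mem_ofPred_eq, key, h0, Complex.conj_conj]
      simp
  · right
    have hr : 0 < Complex.normSq q / (4 * s ^ 2) - 1 := by
      rw [sub_pos, one_lt_div (by positivity)]
      linarith
    have hp : Complex.normSq (conj (-Complex.I * q / (2 * s : ℝ))) =
        Complex.normSq q / (4 * s ^ 2) := by
      rw [Complex.normSq_conj, Complex.normSq_div, Complex.normSq_ofReal]
      simp
      ring
    refine ⟨conj (-Complex.I * q / (2 * s : ℝ)), Real.sqrt (Complex.normSq q / (4 * s ^ 2) - 1),
      Real.sqrt_pos.2 hr, ?_, ?_⟩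
    · rw [← Complex.normSq_eq_norm_sq, Real.sq_sqrt hr.le, hp]
      ring
    · ext z
      simp only [Set.mem_ofPred_eq, key]
      rw [← sq_eq_sq₀ (norm_nonneg _) (Real.sqrt_nonneg _), ← Complex.normSq_eq_norm_sq,
        Real.sq_sqrt hr.le, Complex.normSq_sub, hp, Complex.conj_conj]
      have h3 : ((z : ℂ) * (-Complex.I * q / (2 * s : ℝ))).re = (q * z).im / (2 * s) := by
        rw [mul_div_assoc', Complex.div_ofReal_re]
        congr 1
        simp
        ring
      rw [h3]
      constructor
      · intro h
        rw [h]
        field_simp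
        ring
      · intro h
        field_simp at h
        refine mul_left_cancel₀ (mul_ne_zero four_ne_zero h0) ?_
        linear_combination -h

theorem im_ne_zero_of_isTriangle {A B C : 𝔻} (h : IsTriangle A B C) :
    (conj (recenter A B : ℂ) * recenter A C).im ≠ 0 := by
  intro h0
  have line {e : ℂ} (he : e ≠ 0) (hB : (conj e * recenter A B).im = 0)
      (hC : (conj e * recenter A C).im = 0) : False :=
    h ⟨_, isLine_setOf_im_eq_zero A he, by simp, hB, hC⟩
  by_cases hB : (recenter A B : ℂ) = 0
  · by_cases hC : (recenter A C : ℂ) = 0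
    · exact line one_ne_zero (by simp [hB]) (by simp [hC])
    · exact line hC (by simp [hB]) (by simp; ring)
  · exact line hB (by simp; ring) h0

theorem isTriangle_zero {u v : 𝔻} (h : (conj (u : ℂ) * v).im ≠ 0) : IsTriangle 0 u v := by
  rintro ⟨l, ⟨p, hp, rfl⟩ | ⟨p, r, hr, hpr, rfl⟩, h0, hu, hv⟩
  · simp only [Set.mem_ofPred_eq, Complex.mul_re, Complex.conj_re, Complex.conj_im] at hu hv
    simp only [Complex.mul_im, Complex.conj_re, Complex.conj_im] at h
    refine hp (Complex.ext (mul_right_cancel₀ h ?_) (mul_right_cancel₀ h ?_))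
    · rw [Complex.zero_re]; linear_combination (v : ℂ).im * hu - (u : ℂ).im * hv
    · rw [Complex.zero_im]; linear_combination (u : ℂ).re * hv - (v : ℂ).re * hu
  · simp at h0
    rw [h0] at hpr
    linarith

/-! ### The invariant of a triangle -/

/-- A triangle `ABC` is encoded by a complex number `V` in the upper half-plane of modulus
`tanh (b / 2) tanh (c / 2)` and argument `α`. The area and, given `b` and `c`, the side `a` are
expressed by `V`. -/
theorem exists_invariant {A B C : 𝔻} (h : IsTriangle A B C) :
    ∃ (V : ℂ) (k : ℝ), 0 < V.im ∧ Complex.normSq V < 1 ∧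
      ‖V‖ = Real.tanh (hdist A C / 2) * Real.tanh (hdist A B / 2) ∧
      0 < Real.tanh (hdist A C / 2) ∧ 0 < Real.tanh (hdist A B / 2) ∧
      hangle B A C = V.arg ∧ area A B C = 2 * (1 - conj V).arg ∧ 0 < k ∧
      Real.sinh (hdist B C / 2) ^ 2 = Real.sinh (hdist A C / 2) ^ 2 +
        Real.sinh (hdist A B / 2) ^ 2 + k * (Complex.normSq V - V.re) := by
  have him := im_ne_zero_of_isTriangle h
  rw [← area_recenter A, ← hangle_recenter A, ← hdist_recenter A A, ← hdist_recenter A A,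
    ← hdist_recenter A B, recenter_self]
  generalize recenter A B = u at *
  generalize recenter A C = v at *
  obtain ⟨V, hV, hVuv⟩ : ∃ V : ℂ, 0 < V.im ∧
      (conj (u : ℂ) * v = V ∨ conj (u : ℂ) * v = conj V) := by
    rcases him.lt_or_gt with h | h
    · exact ⟨conj (conj (u : ℂ) * v), by rw [Complex.conj_im]; linarith,
        Or.inr (Complex.conj_conj _).symm⟩
    · exact ⟨_, h, Or.inl rfl⟩
  have hre : V.re = (conj (u : ℂ) * v).re := by rcases hVuv with h | h <;> simp [h]
  have hn : ‖V‖ = ‖(v : ℂ)‖ * ‖(u : ℂ)‖ := by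
    rw [mul_comm, ← Complex.norm_conj (u : ℂ), ← norm_mul]
    rcases hVuv with h | h <;> simp [h]
  have hnsq : Complex.normSq V = Complex.normSq v * Complex.normSq u := by
    rw [Complex.normSq_eq_norm_sq, hn, mul_pow, ← Complex.normSq_eq_norm_sq,
      ← Complex.normSq_eq_norm_sq]
  have hu := sub_pos.2 u.normSq_lt_one
  have hv := sub_pos.2 v.normSq_lt_one
  have hu0 : (u : ℂ) ≠ 0 := fun h => him (by simp [h])
  have hv0 : (v : ℂ) ≠ 0 := fun h => him (by simp [h])
  refine ⟨V, 2 / ((1 - Complex.normSq u) * (1 - Complex.normSq v)), hV, ?_, ?_, ?_, ?_,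
    (hangle_area_zero hV hVuv).1, (hangle_area_zero hV hVuv).2, by positivity, ?_⟩
  · rw [hnsq]
    nlinarith [Complex.normSq_nonneg (u : ℂ), Complex.normSq_nonneg (v : ℂ)]
  · rw [tanh_half_hdist, tanh_half_hdist, recenter_zero, recenter_zero, hn]
  · rw [tanh_half_hdist, recenter_zero]; exact norm_pos_iff.2 hv0
  · rw [tanh_half_hdist, recenter_zero]; exact norm_pos_iff.2 hu0
  · have e : Complex.normSq ((u : ℂ) - v) = Complex.normSq u + Complex.normSq v - 2 * V.re := by
      rw [hre]; simp [Complex.normSq_apply]; ring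
    rw [sinh_sq_half_hdist, sinh_sq_half_hdist_zero, sinh_sq_half_hdist_zero, e, hnsq]
    field_simp
    ring

theorem arg_one_sub_conj_mem_Ioo {V : ℂ} (hV : 0 < V.im) (hV1 : Complex.normSq V < 1) :
    (1 - conj V).arg ∈ Set.Ioo 0 (Real.pi / 2) := by
  refine ⟨arg_pos_of_im_pos (by simpa using hV), ?_⟩
  refine Complex.arg_lt_pi_div_two_iff.2 (Or.inl ?_)
  rw [Complex.normSq_apply] at hV1
  simp
  nlinarith

/-- With `V = P + i Q` and `m = |V|²` one has `Q² + (P - m)² = m |1 - V̄|²`, so that the sine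
`Q / |1 - V̄|` is at most `|V|`, with equality exactly if `P = m`. -/
theorem sin_arg_one_sub_conj {V : ℂ} (hV : 0 < V.im) :
    Real.sin (1 - conj V).arg ≤ ‖V‖ ∧
      (Real.sin (1 - conj V).arg = ‖V‖ ↔ V.re = Complex.normSq V) := by
  have hne : 1 - conj V ≠ 0 := fun h => hV.ne' (by simpa using congrArg Complex.im h)
  have hpos := norm_pos_iff.2 hne
  have key : V.im ^ 2 + (V.re - Complex.normSq V) ^ 2 = (‖V‖ * ‖1 - conj V‖) ^ 2 := by
    rw [mul_pow, ← Complex.normSq_eq_norm_sq, ← Complex.normSq_eq_norm_sq]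
    simp [Complex.normSq_apply]
    ring
  have him : (1 - conj V).im = V.im := by simp
  have hN : 0 ≤ ‖V‖ * ‖1 - conj V‖ := by positivity
  rw [Complex.sin_arg, him, div_le_iff₀ hpos, div_eq_iff hpos.ne', ← sq_le_sq₀ hV.le hN,
    ← sq_eq_sq₀ hV.le hN]
  refine ⟨by nlinarith [sq_nonneg (V.re - Complex.normSq V)], fun h => ?_, fun h => ?_⟩
  · have : (V.re - Complex.normSq V) ^ 2 = 0 := by linarith
    exact sub_eq_zero.1 (pow_eq_zero_iff two_ne_zero |>.1 this)
  · rw [h, sub_self] at key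
    linarith

/-- A triangle with prescribed sides `b`, `c`, given by `y = tanh (b / 2)` and `x = tanh (c / 2)`,
for which `cos α = tanh (b / 2) tanh (c / 2)`. -/
theorem exists_isTriangle {x y : ℝ} (hx : x ∈ Set.Ioo (0 : ℝ) 1) (hy : y ∈ Set.Ioo (0 : ℝ) 1) :
    ∃ A B C : 𝔻, IsTriangle A B C ∧ hdist A B = 2 * Real.artanh x ∧
      hdist A C = 2 * Real.artanh y ∧ Real.cos (hangle B A C) = y * x := by
  obtain ⟨hx0, hx1⟩ := hx
  obtain ⟨hy0, hy1⟩ := hy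
  have hm : 0 < 1 - (y * x) ^ 2 := by
    have : y * x < 1 := by nlinarith
    nlinarith [mul_pos hy0 hx0]
  set s := Real.sqrt (1 - (y * x) ^ 2) with hs
  have hs0 : 0 < s := Real.sqrt_pos.2 hm
  have hs2 : s ^ 2 = 1 - (y * x) ^ 2 := Real.sq_sqrt hm.le
  have hnx : ‖(x : ℂ)‖ = x := by rw [Complex.norm_real, Real.norm_of_nonneg hx0.le]
  have hn1 : ‖(⟨y * x, s⟩ : ℂ)‖ = 1 := by
    rw [← sq_eq_sq₀ (norm_nonneg _) zero_le_one, ← Complex.normSq_eq_norm_sq,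
      Complex.normSq_mk]
    linarith
  have hny : ‖(y : ℂ) * ⟨y * x, s⟩‖ = y := by
    rw [norm_mul, hn1, mul_one, Complex.norm_real, Real.norm_of_nonneg hy0.le]
  let u : 𝔻 := Complex.UnitDisc.mk x (hnx.trans_lt hx1)
  let v : 𝔻 := Complex.UnitDisc.mk (y * ⟨y * x, s⟩) (hny.trans_lt hy1)
  have hu : (u : ℂ) = x := rfl
  have hv : (v : ℂ) = y * ⟨y * x, s⟩ := rfl
  have hW : conj (u : ℂ) * v = (x * y : ℝ) * ⟨y * x, s⟩ := by
    rw [hu, hv, Complex.conj_ofReal]; push_cast; ring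
  have him : 0 < (conj (u : ℂ) * v).im := by
    rw [hW, Complex.im_ofReal_mul]
    positivity
  refine ⟨0, u, v, isTriangle_zero him.ne', ?_, ?_, ?_⟩
  · rw [hdist_zero, hu, hnx]
  · rw [hdist_zero, hv, hny]
  · rw [(hangle_area_zero him (Or.inl rfl)).1, hW, Complex.arg_real_mul _ (mul_pos hx0 hy0),
      Complex.cos_arg (norm_ne_zero_iff.1 (by rw [hn1]; exact one_ne_zero)), hn1, div_one]

/-! ### The equivalences -/

theorem tfae_hasMaximalArea {A B C : 𝔻} (hT : IsTriangle A B C) :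
    List.TFAE [
      HasMaximalArea A B C,
      hangle B A C = hangle A B C + hangle A C B ∧ hangle B A C < Real.pi / 2,
      ∃ O : 𝔻, IsCircumcenter O A B C ∧ IsMidpoint O B C,
      Real.sin (area A B C / 2) = Real.tanh (hdist A C / 2) * Real.tanh (hdist A B / 2),
      Real.cos (hangle B A C) = Real.tanh (hdist A C / 2) * Real.tanh (hdist A B / 2),
      Real.sinh (hdist B C / 2) ^ 2 =
        Real.sinh (hdist A C / 2) ^ 2 + Real.sinh (hdist A B / 2) ^ 2] := by
  obtain ⟨V, k, hV, hV1, hn, hy, hx, hα, hS, hk, hsinh⟩ := exists_invariant hT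
  have hV0 : V ≠ 0 := by rintro rfl; simp at hV
  have hθ := arg_one_sub_conj_mem_Ioo hV hV1
  -- Each of the conditions (1), (3), (4), (5) says that `Re V = |V|²`.
  have h1 : (hangle B A C = hangle A B C + hangle A C B ∧ hangle B A C < Real.pi / 2) ↔
      V.re = Complex.normSq V := by
    have him : (V * (1 - conj V)).im = V.im := by simp; ring
    have hre : (V * (1 - conj V)).re = V.re - Complex.normSq V := by
      simp [Complex.normSq_apply]; ring
    have hsum : V.arg + (1 - conj V).arg = Real.pi / 2 ↔ V.re = Complex.normSq V := by
      rw [← arg_mul_of_im_pos hV (by rwa [him]), Complex.arg_eq_pi_div_two_iff, hre, him,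
        sub_eq_zero, and_iff_left hV]
    rw [← hsum]
    rw [area] at hS
    rw [hα] at hS ⊢
    constructor
    · rintro ⟨h, -⟩
      linarith
    · intro h
      exact ⟨by linarith, by linarith [hθ.1]⟩
  have h3 : Real.sin (area A B C / 2) =
      Real.tanh (hdist A C / 2) * Real.tanh (hdist A B / 2) ↔ V.re = Complex.normSq V := by
    rw [hS, mul_div_cancel_left₀ _ two_ne_zero, ← hn, (sin_arg_one_sub_conj hV).2]
  have h4 : Real.cos (hangle B A C) =
      Real.tanh (hdist A C / 2) * Real.tanh (hdist A B / 2) ↔ V.re = Complex.normSq V := by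
    rw [hα, ← hn, Complex.cos_arg hV0, div_eq_iff (norm_ne_zero_iff.2 hV0),
      Complex.normSq_eq_norm_sq, sq]
  have h5 : Real.sinh (hdist B C / 2) ^ 2 =
      Real.sinh (hdist A C / 2) ^ 2 + Real.sinh (hdist A B / 2) ^ 2 ↔
        V.re = Complex.normSq V := by
    rw [hsinh, add_eq_left, mul_eq_zero, or_iff_right hk.ne', sub_eq_zero]
    exact eq_comm
  tfae_have 2 ↔ 5 := h1.trans h4.symm
  tfae_have 4 ↔ 5 := h3.trans h4.symm
  tfae_have 6 ↔ 5 := h5.trans h4.symm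
  tfae_have 3 ↔ 6 := exists_circumcenter_isMidpoint_iff A B C
  tfae_have 4 → 1 := by
    intro h A' B' C' hT' hb hc
    obtain ⟨V', -, hV', hV1', hn', -, -, -, hS', -, -⟩ := exists_invariant hT'
    have hθ' := arg_one_sub_conj_mem_Ioo hV' hV1'
    have hle := (sin_arg_one_sub_conj hV').1
    rw [hn', hb, hc, ← h, hS, mul_div_cancel_left₀ _ two_ne_zero] at hle
    have := (Real.strictMonoOn_sin.le_iff_le ⟨by linarith [hθ'.1, Real.pi_pos], hθ'.2.le⟩
      ⟨by linarith [hθ.1, Real.pi_pos], hθ.2.le⟩).1 hle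
    rw [hS, hS']
    linarith
  tfae_have 1 → 4 := by
    intro h
    obtain ⟨A', B', C', hT', hc, hb, hcos⟩ :=
      exists_isTriangle ⟨hx, Real.tanh_lt_one _⟩ ⟨hy, Real.tanh_lt_one _⟩
    rw [Real.artanh_tanh, mul_div_cancel₀ _ two_ne_zero] at hb hc
    obtain ⟨V', -, hV', hV1', hn', -, -, hα', hS', -, -⟩ := exists_invariant hT'
    have hV0' : V' ≠ 0 := by rintro rfl; simp at hV'
    have hθ' := arg_one_sub_conj_mem_Ioo hV' hV1'
    rw [hb, hc] at hn'
    have hre : V'.re = Complex.normSq V' := by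
      rw [hα', ← hn', Complex.cos_arg hV0', div_eq_iff (norm_ne_zero_iff.2 hV0')] at hcos
      rw [hcos, Complex.normSq_eq_norm_sq, sq]
    have hsin := (sin_arg_one_sub_conj hV').2.2 hre
    have harea := h A' B' C' hT' hb hc
    rw [hS, hS'] at harea
    have hle := (Real.strictMonoOn_sin.le_iff_le ⟨by linarith [hθ'.1, Real.pi_pos], hθ'.2.le⟩
      ⟨by linarith [hθ.1, Real.pi_pos], hθ.2.le⟩).2 (show (1 - conj V').arg ≤ _ by linarith)
    rw [hS, mul_div_cancel_left₀ _ two_ne_zero, ← hn]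
    refine le_antisymm (sin_arg_one_sub_conj hV).1 ?_
    rw [hn, ← hn', ← hsin]
    exact hle
  tfae_finish

end PoincareDisc

open PoincareDisc in
theorem theorem1 :
    (∀ (b c : ℝ) (A B C : 𝔻), IsTriangle A B C → hdist A C = b → hdist A B = c →
      List.TFAE [
        -- (0) the area is maximal
        HasMaximalArea A B C,
        -- (1) `α = β + γ < π / 2`
        hangle B A C = hangle A B C + hangle A C B ∧ hangle B A C < Real.pi / 2,
        -- (2) the circumcenter is the midpoint of `BC`
        ∃ O : 𝔻, IsCircumcenter O A B C ∧ IsMidpoint O B C,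
        -- (3)
        Real.sin (area A B C / 2) = Real.tanh (b / 2) * Real.tanh (c / 2),
        -- (4)
        Real.cos (hangle B A C) = Real.tanh (b / 2) * Real.tanh (c / 2),
        -- (5)
        Real.sinh (hdist B C / 2) ^ 2 = Real.sinh (b / 2) ^ 2 + Real.sinh (c / 2) ^ 2]) ∧
    -- the value of `cos α` in (4) is not the same for all triangles of maximal area
    ¬ ∃ k : ℝ, ∀ A B C : 𝔻, IsTriangle A B C → HasMaximalArea A B C →
      Real.cos (hangle B A C) = k := by
  refine ⟨?_, ?_⟩
  · rintro b c A B C hT rfl rfl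
    exact tfae_hasMaximalArea hT
  · rintro ⟨k, hk⟩
    -- The isosceles triangles with `tanh (b / 2) = tanh (c / 2) = x` give `k = x²` for all `x`.
    have key {x : ℝ} (hx : x ∈ Set.Ioo (0 : ℝ) 1) : x * x = k := by
      obtain ⟨A, B, C, hT, hc, hb, hcos⟩ := exists_isTriangle hx hx
      have hx' : x ∈ Set.Ioo (-1 : ℝ) 1 := ⟨by linarith [hx.1], hx.2⟩
      rw [← hcos]
      refine hk A B C hT (((tfae_hasMaximalArea hT).out 0 4).2 ?_)
      rw [hcos, hb, hc, mul_div_cancel_left₀ _ two_ne_zero, Real.tanh_artanh hx']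
    have h1 := key (x := 1 / 2) (by norm_num)
    have h2 := key (x := 1 / 3) (by norm_num)
    norm_num [← h1] at h2
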